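/- Let $N\ge 1$ and let $B$ be a real $N\times N$ matrix with $B^T=-B$. On $\mathbb{R}^{N+1}=\mathbb{R}^N_x\times\mathbb{R}_t$ consider the Kolmogorov operator $$\mathscr{L}=\Delta+\langle Bx,\nabla\rangle-\partial_t,$$ where $\Delta$ and $\nabla$ are the Laplacian and the gradient in the variable $x\in\mathbb{R}^N$. Put $E(\tau)=\exp(-\tau B)$ for $\tau\in\mathbb{R}$, and $$(x,t)\circ(y,\tau)=(y+E(\tau)x,\;t+\tau),\qquad P=\Big\{(x,t)\in\mathbb{R}^{N+1}: t<-\frac{|x|^2}{4}\Big\},\qquad P(z_0)=z_0\circ P=\{z_0\circ w: w\in P\}.$$ Then there is a constant $C>0$, independent of $u$ and of $z_0$, such that for every non-negative $C^\infty$ function $u:\mathbb{R}^{N+1}\to\mathbb{R}$ with $\mathscr{L}u=0$ in $\mathbb{R}^{N+1}$ and every $z_0\in\mathbb{R}^{N+1}$, $$u(z)\le C\,u(z_0)\qquad\text{for every } z\in P(z_0).$$ -/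

import Mathlib

open scoped ContDiff

noncomputable section

namespace Kolmogorov

/-- The space-time `ℝ^{N+1} = ℝ^N × ℝ`, with points `z = (x, t)`. -/
abbrev SpaceTime (N : ℕ) : Type := EuclideanSpace ℝ (Fin N) × ℝ

/-- The operator `L = Δ + ⟨Bx, ∇⟩ - ∂ₜ`, where the Laplacian and the gradient act on the space
variable `x` only. -/
def operator {N : ℕ} (B : Matrix (Fin N) (Fin N) ℝ) (u : SpaceTime N → ℝ) (z : SpaceTime N) : ℝ :=
  Laplacian.laplacian (fun x => u (x, z.2)) z.1
    + inner ℝ (Matrix.toEuclideanLin B z.1) (gradient (fun x => u (x, z.2)) z.1)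
    - deriv (fun t => u (z.1, t)) z.2

/-- The matrix `E(τ) = exp(-τB)`. -/
def E {N : ℕ} (B : Matrix (Fin N) (Fin N) ℝ) (τ : ℝ) : Matrix (Fin N) (Fin N) ℝ :=
  NormedSpace.exp (-(τ • B))

/-- The composition law `(x, t) ∘ (y, τ) = (y + E(τ)x, t + τ)`. -/
def comp {N : ℕ} (B : Matrix (Fin N) (Fin N) ℝ) (z w : SpaceTime N) : SpaceTime N :=
  (w.1 + Matrix.toEuclideanLin (E B w.2) z.1, z.2 + w.2)

/-- The paraboloid `P = {(x, t) : t < -|x|²/4}`. -/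
def P (N : ℕ) : Set (SpaceTime N) :=
  {z | z.2 < -(‖z.1‖ ^ 2 / 4)}

/-- The translated paraboloid `P(z₀) = z₀ ∘ P`. -/
def paraboloid {N : ℕ} (B : Matrix (Fin N) (Fin N) ℝ) (z₀ : SpaceTime N) : Set (SpaceTime N) :=
  comp B z₀ '' P N

end Kolmogorov

end

namespace Kolmogorov

open scoped ContDiff
open Set MeasureTheory Filter Topology

/-! Since `B` is skew, `exp(-τB)` is orthogonal. In coordinates carried by this flow the drift is
absorbed into the time derivative and the Laplacian is unchanged, so `u` becomes a solution `v` of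
the heat equation (`exists_heat_solution`). A parabolic dilation then turns the claim into `v (y,
-1) ≤ A * v (0, 0)` for `‖y‖ < 2`, with `A` depending on `N` only (`exists_heat_harnack`).

Nothing is assumed on the growth of `v`, so no representation formula is used. Instead `v` is paired
with test functions compactly supported in space, for which `d/ds ∫ v G = ∫ v (∂ₛG + ΔG)`
(`hasDerivAt_integral_mul`). There are two of them. `H` is a cutoff times the backward heat kernel
with pole `(y, -1 + ε)`; the cutoff costs a bounded error, supported near `y`
(`exists_truncated_gauss_bound`). `G` is a smooth convex function of the kernel with pole `(0, ε)`,
shifted by `a s - c`. The shift makes the support compact, while convexity and `a > 0` make `G` a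
subsolution of the backward equation, strictly so where it is positive (`exists_subsolution`).

On `[-2, -1]` this strict gain, times a large `A`, absorbs the cutoff error, so `A ∫ v G - ∫ v H` is
non-decreasing; it is non-negative at `-2`, hence at `-1`. On `[-1, 0]` the integral `∫ v G` is
itself non-decreasing, and at time `0` it lies below the truncated kernel integral at the origin
(`exists_integral_comparison`). As `ε → 0` the two ends tend to the same multiple of `v (y, -1)` and
of `A * v (0, 0)`. -/

/-- The functions `f₁ i`, `f₂ i` and `f_t` are the continuous partial derivatives `∂ᵢ f`, `∂ᵢ² f`
and `∂ₜ f` of `f` on `ℝ^N × I`. -/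
structure HasParabolicDerivs {N : ℕ} (I : Set ℝ) (f : EuclideanSpace ℝ (Fin N) → ℝ → ℝ)
    (f₁ f₂ : Fin N → EuclideanSpace ℝ (Fin N) → ℝ → ℝ)
    (f_t : EuclideanSpace ℝ (Fin N) → ℝ → ℝ) : Prop where
  line : ∀ s ∈ I, ∀ i x,
    HasLineDerivAt ℝ (fun y => f y s) (f₁ i x s) x (EuclideanSpace.single i (1 : ℝ))
  line₂ : ∀ s ∈ I, ∀ i x,
    HasLineDerivAt ℝ (fun y => f₁ i y s) (f₂ i x s) x (EuclideanSpace.single i (1 : ℝ))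
  time : ∀ s ∈ I, ∀ x, HasDerivAt (f x) (f_t x s) s
  cont : ContinuousOn (fun z : SpaceTime N => f z.1 z.2) (univ ×ˢ I)
  cont₁ : ∀ i, ContinuousOn (fun z : SpaceTime N => f₁ i z.1 z.2) (univ ×ˢ I)
  cont₂ : ∀ i, ContinuousOn (fun z : SpaceTime N => f₂ i z.1 z.2) (univ ×ˢ I)
  cont_t : ContinuousOn (fun z : SpaceTime N => f_t z.1 z.2) (univ ×ˢ I)

/-! ### Pairing with test functions compactly supported in space -/

theorem continuous_slice {N : ℕ} {I : Set ℝ} {f : EuclideanSpace ℝ (Fin N) → ℝ → ℝ}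
    (hf : ContinuousOn (fun z : SpaceTime N => f z.1 z.2) (univ ×ˢ I)) {s : ℝ} (hs : s ∈ I) :
    Continuous fun x => f x s := by
  rw [← continuousOn_univ]
  exact hf.comp (f := fun x : EuclideanSpace ℝ (Fin N) => (x, s)) (by fun_prop)
    fun x hx => ⟨hx, hs⟩

theorem tsupport_lineDeriv_subset {E : Type*} [NormedAddCommGroup E] [NormedSpace ℝ E]
    {f f' : E → ℝ} {e : E} (h : ∀ x, HasLineDerivAt ℝ f (f' x) x e) :
    tsupport f' ⊆ tsupport f := by
  refine closure_minimal (fun x hx => ?_) (isClosed_tsupport f)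
  by_contra hxf
  have h0 : f =ᶠ[𝓝 x] fun _ => 0 := notMem_tsupport_iff_eventuallyEq.1 hxf
  have h1 : HasLineDerivAt ℝ (fun _ : E => (0 : ℝ)) (f' x) x e :=
    (h x).congr_of_eventuallyEq h0.symm
  have h2 : HasLineDerivAt ℝ (fun _ : E => (0 : ℝ)) 0 x e := by
    simp [HasLineDerivAt, hasDerivAt_const]
  exact hx (h1.unique h2)

/-- Two integrations by parts. Compact support of `G` passes to its derivatives and makes every
product integrable, whatever the growth of `v`. -/
theorem integral_mul_lineDeriv_lineDeriv {N : ℕ}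
    {v v₁ v₂ G G₁ G₂ : EuclideanSpace ℝ (Fin N) → ℝ} {e : EuclideanSpace ℝ (Fin N)}
    (hv : ∀ x, HasLineDerivAt ℝ v (v₁ x) x e) (hv₁ : ∀ x, HasLineDerivAt ℝ v₁ (v₂ x) x e)
    (hG : ∀ x, HasLineDerivAt ℝ G (G₁ x) x e) (hG₁ : ∀ x, HasLineDerivAt ℝ G₁ (G₂ x) x e)
    (cv : Continuous v) (cv₁ : Continuous v₁) (cv₂ : Continuous v₂)
    (cG : Continuous G) (cG₁ : Continuous G₁) (cG₂ : Continuous G₂) (hc : HasCompactSupport G) :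
    ∫ x, v₂ x * G x = ∫ x, v x * G₂ x := by
  have hc₁ : HasCompactSupport G₁ :=
    hc.of_isClosed_subset (isClosed_tsupport _) (tsupport_lineDeriv_subset hG)
  have hc₂ : HasCompactSupport G₂ :=
    hc₁.of_isClosed_subset (isClosed_tsupport _) (tsupport_lineDeriv_subset hG₁)
  have key1 := integral_bilinear_hasLineDerivAt_right_eq_neg_left_of_integrable
    (μ := (volume : Measure (EuclideanSpace ℝ (Fin N)))) (B := ContinuousLinearMap.mul ℝ ℝ)
    (f := v₁) (f' := v₂) (g := G) (g' := G₁) (v := e)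
    ((cv₂.mul cG).integrable_of_hasCompactSupport hc.mul_left)
    ((cv₁.mul cG₁).integrable_of_hasCompactSupport hc₁.mul_left)
    ((cv₁.mul cG).integrable_of_hasCompactSupport hc.mul_left)
    (fun x _ => hv₁ x) (fun x _ => hG x)
  have key2 := integral_bilinear_hasLineDerivAt_right_eq_neg_left_of_integrable
    (μ := (volume : Measure (EuclideanSpace ℝ (Fin N)))) (B := ContinuousLinearMap.mul ℝ ℝ)
    (f := v) (f' := v₁) (g := G₁) (g' := G₂) (v := e)
    ((cv₁.mul cG₁).integrable_of_hasCompactSupport hc₁.mul_left)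
    ((cv.mul cG₂).integrable_of_hasCompactSupport hc₂.mul_left)
    ((cv.mul cG₁).integrable_of_hasCompactSupport hc₁.mul_left)
    (fun x _ => hv x) (fun x _ => hG₁ x)
  simp only [ContinuousLinearMap.mul_apply'] at key1 key2
  linarith

/-- The time derivative vanishes outside the same ball as `f`, so its maximum over that ball and a
short closed time interval dominates it. -/
theorem hasDerivAt_integral_of_compact {N : ℕ} {I : Set ℝ} (hI : IsOpen I)
    {f f_t : EuclideanSpace ℝ (Fin N) → ℝ → ℝ} {R : ℝ}
    (hf : ContinuousOn (fun z : SpaceTime N => f z.1 z.2) (univ ×ˢ I))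
    (hf_t : ContinuousOn (fun z : SpaceTime N => f_t z.1 z.2) (univ ×ˢ I))
    (hd : ∀ s ∈ I, ∀ x, HasDerivAt (f x) (f_t x s) s)
    (hR : ∀ s ∈ I, ∀ x, R ≤ ‖x‖ → f x s = 0) {s : ℝ} (hs : s ∈ I) :
    HasDerivAt (fun r => ∫ x, f x r) (∫ x, f_t x s) s := by
  obtain ⟨δ, hδ, hball⟩ := Metric.isOpen_iff.1 hI s hs
  have hsub : Metric.closedBall s (δ / 2) ⊆ I :=
    (Metric.closedBall_subset_ball (by linarith)).trans hball
  have hcomp : ∀ r ∈ I, HasCompactSupport fun x => f x r := fun r hr =>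
    HasCompactSupport.intro (isCompact_closedBall (0 : EuclideanSpace ℝ (Fin N)) R) fun x hx => by
      rw [mem_closedBall_zero_iff, not_le] at hx
      exact hR r hr x hx.le
  have hR' : ∀ r ∈ I, ∀ x, R ≤ ‖x‖ → f_t x r = 0 := fun r hr x hx => by
    have h0 : f x =ᶠ[𝓝 r] fun _ => 0 := by
      filter_upwards [hI.mem_nhds hr] with t ht using hR t ht x hx
    exact (hd r hr x).unique ((hasDerivAt_const r (0 : ℝ)).congr_of_eventuallyEq h0)
  obtain ⟨M, hM⟩ := ((isCompact_closedBall (0 : EuclideanSpace ℝ (Fin N)) R).prod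
    (isCompact_closedBall s (δ / 2))).exists_bound_of_continuousOn
      (hf_t.mono (prod_mono (subset_univ _) hsub))
  refine (hasDerivAt_integral_of_dominated_loc_of_deriv_le
    (bound := (Metric.closedBall (0 : EuclideanSpace ℝ (Fin N)) R).indicator fun _ => M)
    (F := fun r x => f x r) (F' := fun r x => f_t x r)
    (Metric.closedBall_mem_nhds s (half_pos hδ)) ?_ ?_ ?_ ?_ ?_ ?_).2
  · filter_upwards [hI.mem_nhds hs] with r hr
    exact (continuous_slice hf hr).aestronglyMeasurable
  · exact (continuous_slice hf hs).integrable_of_hasCompactSupport (hcomp s hs)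
  · exact (continuous_slice hf_t hs).aestronglyMeasurable
  · refine Eventually.of_forall fun x r hr => ?_
    by_cases hx : x ∈ Metric.closedBall (0 : EuclideanSpace ℝ (Fin N)) R
    · rw [indicator_of_mem hx]
      exact hM (x, r) ⟨hx, hr⟩
    · rw [indicator_of_notMem hx]
      rw [mem_closedBall_zero_iff, not_le] at hx
      rw [hR' r (hsub hr) x hx.le, norm_zero]
  · exact (integrable_indicator_iff measurableSet_closedBall).2
      (integrableOn_const (isCompact_closedBall _ _).measure_lt_top.ne)
  · exact Eventually.of_forall fun x r hr => hd r (hsub hr) x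

/-- If `v` solves the heat equation and `G` has compact support in space, then
`d/ds ∫ v G = ∫ v (∂ₛ G + Δ G)`. -/
theorem hasDerivAt_integral_mul {N : ℕ} {I : Set ℝ} (hI : IsOpen I)
    {v v_t G G_t : EuclideanSpace ℝ (Fin N) → ℝ → ℝ}
    {v₁ v₂ G₁ G₂ : Fin N → EuclideanSpace ℝ (Fin N) → ℝ → ℝ} {R : ℝ}
    (hv : HasParabolicDerivs I v v₁ v₂ v_t) (hheat : ∀ s ∈ I, ∀ x, ∑ i, v₂ i x s = v_t x s)
    (hG : HasParabolicDerivs I G G₁ G₂ G_t)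
    (hR : ∀ s ∈ I, ∀ x, R ≤ ‖x‖ → G x s = 0) {s : ℝ} (hs : s ∈ I) :
    HasDerivAt (fun r => ∫ x, v x r * G x r) (∫ x, v x s * (G_t x s + ∑ i, G₂ i x s)) s ∧
      Integrable (fun x => v x s * (G_t x s + ∑ i, G₂ i x s)) ∧
      Integrable fun x => v x s * G x s := by
  have h := hasDerivAt_integral_of_compact hI (f := fun x r => v x r * G x r)
    (f_t := fun x r => v_t x r * G x r + v x r * G_t x r) (R := R)
    (hv.cont.mul hG.cont) ((hv.cont_t.mul hG.cont).add (hv.cont.mul hG.cont_t))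
    (fun r hr x => (hv.time r hr x).mul (hG.time r hr x))
    (fun r hr x hx => by simp [hR r hr x hx]) hs
  have hc : HasCompactSupport fun x => G x s :=
    HasCompactSupport.intro (isCompact_closedBall (0 : EuclideanSpace ℝ (Fin N)) R) fun x hx => by
      rw [mem_closedBall_zero_iff, not_le] at hx
      exact hR s hs x hx.le
  have hc₂ : ∀ i, HasCompactSupport fun x => G₂ i x s := fun i =>
    (hc.of_isClosed_subset (isClosed_tsupport _)
      (tsupport_lineDeriv_subset (hG.line s hs i))).of_isClosed_subset (isClosed_tsupport _)
      (tsupport_lineDeriv_subset (hG.line₂ s hs i))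
  have hct : HasCompactSupport fun x => G_t x s :=
    HasCompactSupport.intro (isCompact_closedBall (0 : EuclideanSpace ℝ (Fin N)) R) fun x hx => by
      rw [mem_closedBall_zero_iff, not_le] at hx
      have h0 : G x =ᶠ[𝓝 s] fun _ => 0 := by
        filter_upwards [hI.mem_nhds hs] with t ht using hR t ht x hx.le
      exact (hG.time s hs x).unique ((hasDerivAt_const s (0 : ℝ)).congr_of_eventuallyEq h0)
  have cv := continuous_slice hv.cont hs
  have cG := continuous_slice hG.cont hs
  have e1 : ∀ i, ∫ x, v₂ i x s * G x s = ∫ x, v x s * G₂ i x s := fun i =>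
    integral_mul_lineDeriv_lineDeriv (hv.line s hs i) (hv.line₂ s hs i) (hG.line s hs i)
      (hG.line₂ s hs i) cv (continuous_slice (hv.cont₁ i) hs) (continuous_slice (hv.cont₂ i) hs)
      cG (continuous_slice (hG.cont₁ i) hs) (continuous_slice (hG.cont₂ i) hs) hc
  have i1 : ∀ i, Integrable fun x => v x s * G₂ i x s := fun i =>
    (cv.mul (continuous_slice (hG.cont₂ i) hs)).integrable_of_hasCompactSupport (hc₂ i).mul_left
  have i2 : ∀ i, Integrable fun x => v₂ i x s * G x s := fun i =>
    ((continuous_slice (hv.cont₂ i) hs).mul cG).integrable_of_hasCompactSupport hc.mul_left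
  have i3 : Integrable fun x => v x s * G_t x s :=
    (cv.mul (continuous_slice hG.cont_t hs)).integrable_of_hasCompactSupport hct.mul_left
  have i4 : Integrable fun x => v_t x s * G x s :=
    ((continuous_slice hv.cont_t hs).mul cG).integrable_of_hasCompactSupport hc.mul_left
  simp only [mul_add, Finset.mul_sum]
  refine ⟨h.congr_deriv ?_, i3.add (integrable_finsetSum _ fun i _ => i1 i),
    (cv.mul cG).integrable_of_hasCompactSupport hc.mul_left⟩
  rw [integral_add i4 i3]
  rw [integral_add i3 (integrable_finsetSum _ fun i _ => i1 i),
    integral_finsetSum _ fun i _ => i1 i, add_comm]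
  congr 1
  symm
  rw [← Finset.sum_congr rfl fun i _ => e1 i, ← integral_finsetSum _ fun i _ => i2 i]
  refine integral_congr_ae (Eventually.of_forall fun x => ?_)
  simp only [← Finset.sum_mul, hheat s hs x]

/-! ### Calculus rules for the partial derivatives -/

namespace HasParabolicDerivs

variable {N : ℕ} {I J : Set ℝ} {f g f_t g_t : EuclideanSpace ℝ (Fin N) → ℝ → ℝ}
  {f₁ f₂ g₁ g₂ : Fin N → EuclideanSpace ℝ (Fin N) → ℝ → ℝ}

theorem mono (h : HasParabolicDerivs I f f₁ f₂ f_t) (hJ : J ⊆ I) :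
    HasParabolicDerivs J f f₁ f₂ f_t where
  line s hs := h.line s (hJ hs)
  line₂ s hs := h.line₂ s (hJ hs)
  time s hs := h.time s (hJ hs)
  cont := h.cont.mono (prod_mono_right hJ)
  cont₁ i := (h.cont₁ i).mono (prod_mono_right hJ)
  cont₂ i := (h.cont₂ i).mono (prod_mono_right hJ)
  cont_t := h.cont_t.mono (prod_mono_right hJ)

theorem _root_.Kolmogorov.hasLineDerivAt_slice {w : SpaceTime N → ℝ} {x : EuclideanSpace ℝ (Fin N)}
    {s : ℝ} {w' : SpaceTime N →L[ℝ] ℝ} (hw : HasFDerivAt w w' (x, s))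
    (e : EuclideanSpace ℝ (Fin N)) :
    HasLineDerivAt ℝ (fun y => w (y, s)) (w' (e, 0)) x e := by
  have hcurve : HasDerivAt (fun t : ℝ => (x + t • e, s)) (e, (0 : ℝ)) 0 := by
    refine HasDerivAt.prodMk ?_ (hasDerivAt_const _ _)
    simpa using ((hasDerivAt_id (0 : ℝ)).smul_const e).const_add x
  have h : HasFDerivAt w w' (x + (0 : ℝ) • e, s) := by
    rw [zero_smul, add_zero]; exact hw
  exact h.comp_hasDerivAt (0 : ℝ) hcurve

theorem of_contDiff {u : SpaceTime N → ℝ} (hu : ContDiff ℝ ∞ u) (I : Set ℝ) :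
    HasParabolicDerivs I (fun x s => u (x, s))
      (fun i x s => fderiv ℝ u (x, s) (EuclideanSpace.single i 1, 0))
      (fun i x s => fderiv ℝ (fderiv ℝ u) (x, s) (EuclideanSpace.single i 1, 0)
        (EuclideanSpace.single i 1, 0))
      (fun x s => fderiv ℝ u (x, s) (0, 1)) := by
  have hu' : ContDiff ℝ ∞ (fderiv ℝ u) := hu.fderiv_right (by simp)
  have hu'' : ContDiff ℝ ∞ (fderiv ℝ (fderiv ℝ u)) := hu'.fderiv_right (by simp)
  have hd : Differentiable ℝ u := hu.differentiable (by simp)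
  have hd' : Differentiable ℝ (fderiv ℝ u) := hu'.differentiable (by simp)
  refine ⟨fun s _ i x => hasLineDerivAt_slice (hd _).hasFDerivAt _, fun s _ i x => ?_,
    fun s _ x => ?_, hu.continuous.continuousOn, fun i => ?_, fun i => ?_, ?_⟩
  · have h := (ContinuousLinearMap.apply ℝ ℝ
      ((EuclideanSpace.single i 1, 0) : SpaceTime N)).hasFDerivAt.comp (x, s)
      (hd' (x, s)).hasFDerivAt
    exact hasLineDerivAt_slice h (EuclideanSpace.single i 1)
  · exact (hd (x, s)).hasFDerivAt.comp_hasDerivAt s ((hasDerivAt_const s x).prodMk (hasDerivAt_id s))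
  · exact (hu'.continuous.clm_apply continuous_const).continuousOn
  · exact ((hu''.continuous.clm_apply continuous_const).clm_apply continuous_const).continuousOn
  · exact (hu'.continuous.clm_apply continuous_const).continuousOn

theorem comp_sub (h : HasParabolicDerivs I f f₁ f₂ f_t) (y : EuclideanSpace ℝ (Fin N)) :
    HasParabolicDerivs I (fun x => f (x - y)) (fun i x => f₁ i (x - y)) (fun i x => f₂ i (x - y))
      (fun x => f_t (x - y)) := by
  have hc : ContinuousOn (fun z : SpaceTime N => ((z.1 - y, z.2) : SpaceTime N)) (univ ×ˢ I) := by
    fun_prop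
  have hm : MapsTo (fun z : SpaceTime N => ((z.1 - y, z.2) : SpaceTime N)) (univ ×ˢ I)
      (univ ×ˢ I) := fun z hz => ⟨mem_univ _, hz.2⟩
  refine ⟨fun s hs i x => ?_, fun s hs i x => ?_, fun s hs x => h.time s hs (x - y),
    h.cont.comp hc hm, fun i => (h.cont₁ i).comp hc hm, fun i => (h.cont₂ i).comp hc hm,
    h.cont_t.comp hc hm⟩
  · have := h.line s hs i (x - y)
    simpa only [HasLineDerivAt, sub_add_eq_add_sub] using this
  · have := h.line₂ s hs i (x - y)
    simpa only [HasLineDerivAt, sub_add_eq_add_sub] using this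

theorem comp (h : HasParabolicDerivs I f f₁ f₂ f_t) {F F' F'' : ℝ → ℝ}
    (hF : ∀ r, HasDerivAt F (F' r) r) (hF' : ∀ r, HasDerivAt F' (F'' r) r)
    (hF'' : Continuous F'') :
    HasParabolicDerivs I (fun x s => F (f x s)) (fun i x s => F' (f x s) * f₁ i x s)
      (fun i x s => F'' (f x s) * f₁ i x s ^ 2 + F' (f x s) * f₂ i x s)
      (fun x s => F' (f x s) * f_t x s) := by
  have cF : Continuous F := continuous_iff_continuousAt.2 fun r => (hF r).continuousAt
  have cF' : Continuous F' := continuous_iff_continuousAt.2 fun r => (hF' r).continuousAt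
  have key : ∀ {K K' : ℝ → ℝ}, (∀ r, HasDerivAt K (K' r) r) → ∀ s ∈ I, ∀ i x,
      HasLineDerivAt ℝ (fun y => K (f y s)) (K' (f x s) * f₁ i x s) x
        (EuclideanSpace.single i (1 : ℝ)) := fun {K K'} hK s hs i x => by
    have h0 : HasDerivAt K (K' (f x s)) (f (x + (0 : ℝ) • EuclideanSpace.single i (1 : ℝ)) s) := by
      rw [zero_smul, add_zero]; exact hK (f x s)
    exact h0.comp (0 : ℝ) (h.line s hs i x)
  refine ⟨key hF, fun s hs i x => ?_, fun s hs x => (hF _).comp s (h.time s hs x),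
    cF.comp_continuousOn h.cont, fun i => (cF'.comp_continuousOn h.cont).mul (h.cont₁ i),
    fun i => ((hF''.comp_continuousOn h.cont).mul ((h.cont₁ i).pow 2)).add
      ((cF'.comp_continuousOn h.cont).mul (h.cont₂ i)),
    (cF'.comp_continuousOn h.cont).mul h.cont_t⟩
  refine (HasDerivAt.fun_mul (key hF' s hs i x) (h.line₂ s hs i x)).congr_deriv ?_
  simp only [zero_smul, add_zero]
  ring

theorem mul (hf : HasParabolicDerivs I f f₁ f₂ f_t) (hg : HasParabolicDerivs I g g₁ g₂ g_t) :
    HasParabolicDerivs I (fun x s => f x s * g x s)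
      (fun i x s => f₁ i x s * g x s + f x s * g₁ i x s)
      (fun i x s => f₂ i x s * g x s + 2 * (f₁ i x s * g₁ i x s) + f x s * g₂ i x s)
      (fun x s => f_t x s * g x s + f x s * g_t x s) := by
  refine ⟨fun s hs i x => ?_, fun s hs i x => ?_, fun s hs x => (hf.time s hs x).mul (hg.time s hs x),
    hf.cont.mul hg.cont, fun i => ((hf.cont₁ i).mul hg.cont).add (hf.cont.mul (hg.cont₁ i)),
    fun i => (((hf.cont₂ i).mul hg.cont).add
      (continuousOn_const.mul ((hf.cont₁ i).mul (hg.cont₁ i)))).add (hf.cont.mul (hg.cont₂ i)),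
    (hf.cont_t.mul hg.cont).add (hf.cont.mul hg.cont_t)⟩
  · exact (HasDerivAt.fun_mul (hf.line s hs i x) (hg.line s hs i x)).congr_deriv (by simp)
  · refine ((HasDerivAt.fun_mul (hf.line₂ s hs i x) (hg.line s hs i x)).fun_add
      (HasDerivAt.fun_mul (hf.line s hs i x) (hg.line₂ s hs i x))).congr_deriv ?_
    simp only [zero_smul, add_zero]
    ring

theorem add_affine (h : HasParabolicDerivs I f f₁ f₂ f_t) (a c : ℝ) :
    HasParabolicDerivs I (fun x s => f x s + (a * s - c)) f₁ f₂ (fun x s => f_t x s + a) := by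
  refine ⟨fun s hs i x => HasDerivAt.add_const _ (h.line s hs i x), h.line₂, fun s hs x => ?_,
    h.cont.add (by fun_prop), h.cont₁, h.cont₂, h.cont_t.add continuousOn_const⟩
  exact ((h.time s hs x).fun_add (((hasDerivAt_id s).const_mul a).sub_const c)).congr_deriv
    (by simp)

end HasParabolicDerivs

/-! ### The backward heat kernel -/

/-- The heat kernel at time `τ`, without its normalising constant. -/
noncomputable def gauss {N : ℕ} (x : EuclideanSpace ℝ (Fin N)) (τ : ℝ) : ℝ :=
  τ ^ (-(N / 2 : ℝ)) * Real.exp (-(‖x‖ ^ 2 / (4 * τ)))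

theorem gauss_nonneg {N : ℕ} (x : EuclideanSpace ℝ (Fin N)) {τ : ℝ} (hτ : 0 < τ) :
    0 ≤ gauss x τ := by
  unfold gauss; positivity

theorem hasLineDerivAt_norm_sq {N : ℕ} (i : Fin N) (x : EuclideanSpace ℝ (Fin N)) :
    HasLineDerivAt ℝ (fun y => ‖y‖ ^ 2) (2 * x i) x (EuclideanSpace.single i (1 : ℝ)) := by
  have h := ((hasStrictFDerivAt_norm_sq x).hasFDerivAt).hasLineDerivAt
    (EuclideanSpace.single i (1 : ℝ))
  simpa [EuclideanSpace.inner_single_right, two_mul] using h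

theorem hasLineDerivAt_apply {N : ℕ} (i : Fin N) (x : EuclideanSpace ℝ (Fin N)) :
    HasLineDerivAt ℝ (fun y => y i) 1 x (EuclideanSpace.single i (1 : ℝ)) := by
  simpa [HasLineDerivAt] using (hasDerivAt_id (0 : ℝ)).const_add (x i)

/-- The heat kernel with pole at time `b` solves the backward heat equation for times `< b`. -/
theorem hasParabolicDerivs_gauss {N : ℕ} (b : ℝ) :
    HasParabolicDerivs (N := N) (Iio b) (fun x s => gauss x (b - s))
      (fun i x s => -(x i / (2 * (b - s))) * gauss x (b - s))
      (fun i x s => (x i ^ 2 / (4 * (b - s) ^ 2) - 1 / (2 * (b - s))) * gauss x (b - s))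
      (fun x s => -(‖x‖ ^ 2 / (4 * (b - s) ^ 2) - N / (2 * (b - s))) * gauss x (b - s)) := by
  have hline : ∀ τ : ℝ, 0 < τ → ∀ i x, HasLineDerivAt ℝ (fun y => gauss (N := N) y τ)
      (-(x i / (2 * τ)) * gauss x τ) x (EuclideanSpace.single i (1 : ℝ)) := fun τ hτ i x => by
    refine (HasDerivAt.const_mul (τ ^ (-(N / 2 : ℝ))) (HasDerivAt.exp (HasDerivAt.fun_neg
      (HasDerivAt.div_const (hasLineDerivAt_norm_sq i x) (4 * τ))))).congr_deriv ?_
    simp only [zero_smul, add_zero, gauss]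
    field_simp
    ring
  have cg : ContinuousOn (fun z : SpaceTime N => gauss z.1 (b - z.2)) (univ ×ˢ Iio b) := by
    unfold gauss
    refine ContinuousOn.mul (ContinuousOn.rpow_const (by fun_prop) fun z hz => Or.inl ?_)
      (Real.continuous_exp.comp_continuousOn
        ((ContinuousOn.div (by fun_prop) (by fun_prop) fun z hz => ?_).neg))
    · exact (sub_pos.2 hz.2).ne'
    · exact mul_ne_zero four_ne_zero (sub_pos.2 hz.2).ne'
  have hne : ∀ z ∈ (univ ×ˢ Iio b : Set (SpaceTime N)), b - z.2 ≠ 0 := fun z hz =>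
    (sub_pos.2 hz.2).ne'
  refine ⟨fun s hs i x => hline _ (sub_pos.2 hs) i x, fun s hs i x => ?_, fun s hs x => ?_, cg,
    fun i => ContinuousOn.mul ?_ cg, fun i => ContinuousOn.mul ?_ cg, ContinuousOn.mul ?_ cg⟩
  · have hτ : 0 < b - s := sub_pos.2 hs
    refine (HasDerivAt.fun_mul (HasDerivAt.fun_neg (HasDerivAt.div_const
      (hasLineDerivAt_apply i x) (2 * (b - s)))) (hline _ hτ i x)).congr_deriv ?_
    simp only [zero_smul, add_zero]
    field_simp
    ring
  · have hτ : 0 < b - s := sub_pos.2 hs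
    have h0 : HasDerivAt (fun r : ℝ => b - r) (-1) s := by
      simpa using (hasDerivAt_id s).const_sub b
    have h1 := h0.rpow_const (p := -(N / 2 : ℝ)) (Or.inl hτ.ne')
    have h2 := (((hasDerivAt_const s (‖x‖ ^ 2)).fun_div (h0.const_mul 4)
      (by positivity)).fun_neg).exp
    refine (h1.fun_mul h2).congr_deriv ?_
    rw [gauss, Real.rpow_sub_one hτ.ne']
    field_simp
    ring
  · refine (ContinuousOn.div (by fun_prop) (by fun_prop) fun z hz => ?_).neg
    exact mul_ne_zero two_ne_zero (hne z hz)
  · refine ContinuousOn.sub (ContinuousOn.div (by fun_prop) (by fun_prop) fun z hz => ?_)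
      (ContinuousOn.div (by fun_prop) (by fun_prop) fun z hz => ?_)
    · exact mul_ne_zero four_ne_zero (pow_ne_zero 2 (hne z hz))
    · exact mul_ne_zero two_ne_zero (hne z hz)
  · refine (ContinuousOn.sub (ContinuousOn.div (by fun_prop) (by fun_prop) fun z hz => ?_)
      (ContinuousOn.div (by fun_prop) (by fun_prop) fun z hz => ?_)).neg
    · exact mul_ne_zero four_ne_zero (pow_ne_zero 2 (hne z hz))
    · exact mul_ne_zero two_ne_zero (hne z hz)

theorem sum_gauss_laplacian {N : ℕ} (x : EuclideanSpace ℝ (Fin N)) (τ : ℝ) :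
    ∑ i, (x i ^ 2 / (4 * τ ^ 2) - 1 / (2 * τ)) * gauss x τ
      = (‖x‖ ^ 2 / (4 * τ ^ 2) - N / (2 * τ)) * gauss x τ := by
  rw [← Finset.sum_mul, Finset.sum_sub_distrib, ← Finset.sum_div, EuclideanSpace.real_norm_sq_eq]
  simp [div_eq_mul_inv]

/-- This is `z ≤ exp z` at `z = κ / (p τ)`, raised to the power `p`. -/
theorem rpow_neg_mul_exp_neg_le {p κ τ : ℝ} (hp : 0 < p) (hκ : 0 < κ) (hτ : 0 < τ) :
    τ ^ (-p) * Real.exp (-(κ / τ)) ≤ (p / κ) ^ p := by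
  have h1 : κ / p / τ ≤ Real.exp (κ / p / τ) := by
    linarith [Real.add_one_le_exp (κ / p / τ)]
  have h2 : (κ / p / τ) ^ p ≤ Real.exp (κ / τ) := by
    calc (κ / p / τ) ^ p ≤ Real.exp (κ / p / τ) ^ p :=
          Real.rpow_le_rpow (by positivity) h1 hp.le
      _ = Real.exp (κ / τ) := by
          rw [← Real.exp_mul]; congr 1; field_simp
  have h3 : τ ^ (-p) = (p / κ) ^ p * (κ / p / τ) ^ p := by
    rw [← Real.mul_rpow (by positivity) (by positivity), Real.rpow_neg hτ.le,
      ← Real.inv_rpow hτ.le]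
    congr 1; field_simp
  rw [h3, mul_assoc]
  refine mul_le_of_le_one_right (by positivity) ?_
  rw [Real.exp_neg]
  exact mul_inv_le_one_of_le₀ h2 (Real.exp_pos _).le

/-! ### A smooth convex substitute for the positive part -/

/-- The smooth convex function `r e^{-1/r}`, extended by zero to `r ≤ 0`. -/
noncomputable def convexGlue (r : ℝ) : ℝ := r * expNegInvGlue r

/-- The derivative of `convexGlue`. -/
noncomputable def convexGlueDeriv (r : ℝ) : ℝ := (1 + r⁻¹) * expNegInvGlue r

/-- The second derivative of `convexGlue`. -/
noncomputable def convexGlueDeriv₂ (r : ℝ) : ℝ := r⁻¹ ^ 3 * expNegInvGlue r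

theorem hasDerivAt_convexGlue (r : ℝ) : HasDerivAt convexGlue (convexGlueDeriv r) r := by
  have h : HasDerivAt expNegInvGlue ((r ^ 2)⁻¹ * expNegInvGlue r) r := by
    simpa using expNegInvGlue.hasDerivAt_polynomial_eval_inv_mul 1 r
  refine ((hasDerivAt_id r).fun_mul h).congr_deriv ?_
  rcases eq_or_ne r 0 with rfl | hr
  · simp [convexGlueDeriv]
  · simp only [convexGlueDeriv, id]
    field_simp

theorem hasDerivAt_convexGlueDeriv (r : ℝ) : HasDerivAt convexGlueDeriv (convexGlueDeriv₂ r) r := by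
  have h := expNegInvGlue.hasDerivAt_polynomial_eval_inv_mul (1 + Polynomial.X) r
  simp only [Polynomial.eval_add, Polynomial.eval_one, Polynomial.eval_X, Polynomial.eval_mul,
    Polynomial.eval_pow, Polynomial.eval_sub, Polynomial.derivative_add, Polynomial.derivative_one,
    Polynomial.derivative_X, Polynomial.eval_zero] at h
  refine h.congr_deriv ?_
  simp only [convexGlueDeriv₂]
  ring

theorem continuous_convexGlueDeriv₂ : Continuous convexGlueDeriv₂ := by
  have h := expNegInvGlue.continuous_polynomial_eval_inv_mul (Polynomial.X ^ 3)
  simp only [Polynomial.eval_pow, Polynomial.eval_X] at h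
  exact h

theorem convexGlueDeriv_nonneg (r : ℝ) : 0 ≤ convexGlueDeriv r := by
  rcases le_or_gt r 0 with h | h
  · simp [convexGlueDeriv, expNegInvGlue.zero_of_nonpos h]
  · exact mul_nonneg (by positivity) (expNegInvGlue.nonneg r)

theorem convexGlueDeriv₂_nonneg (r : ℝ) : 0 ≤ convexGlueDeriv₂ r := by
  rcases le_or_gt r 0 with h | h
  · simp [convexGlueDeriv₂, expNegInvGlue.zero_of_nonpos h]
  · exact mul_nonneg (by positivity) (expNegInvGlue.nonneg r)

theorem convexGlue_of_nonpos {r : ℝ} (h : r ≤ 0) : convexGlue r = 0 := by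
  simp [convexGlue, expNegInvGlue.zero_of_nonpos h]

theorem convexGlue_nonneg (r : ℝ) : 0 ≤ convexGlue r := by
  rcases le_or_gt r 0 with h | h
  · exact (convexGlue_of_nonpos h).ge
  · exact mul_nonneg h.le (expNegInvGlue.nonneg r)

theorem convexGlue_le {r g : ℝ} (hg : 0 ≤ g) (h : r ≤ g) : convexGlue r ≤ g := by
  rcases le_or_gt r 0 with h0 | h0
  · exact (convexGlue_of_nonpos h0).trans_le hg
  · refine le_trans (mul_le_of_le_one_right h0.le ?_) h
    simp only [expNegInvGlue, not_le.2 h0, if_false]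
    exact Real.exp_le_one_iff.2 (neg_nonpos.2 (inv_pos.2 h0).le)

/-! ### Pointwise bounds on the heat kernel -/

/-- Away from the origin the exponential beats every power of `1 / τ`. The extra factor `τ⁻¹` is the
one produced by the space gradient of the kernel; the bound is uniform as `τ → 0`. -/
theorem inv_mul_gauss_le {N : ℕ} {r : ℝ} (hr : 0 < r) {x : EuclideanSpace ℝ (Fin N)}
    (hx : r ≤ ‖x‖) {τ : ℝ} (hτ : 0 < τ) :
    τ⁻¹ * gauss x τ ≤ ((N / 2 + 1) / (r ^ 2 / 4)) ^ (N / 2 + 1 : ℝ) := by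
  refine le_trans ?_ (rpow_neg_mul_exp_neg_le (τ := τ) (by positivity) (by positivity) hτ)
  rw [gauss, ← mul_assoc, neg_add, Real.rpow_add hτ, Real.rpow_neg_one, mul_comm τ⁻¹]
  refine mul_le_mul_of_nonneg_left (Real.exp_le_exp.2 (neg_le_neg ?_)) (by positivity)
  rw [div_div]
  gcongr

/-- Uniform smallness far away, which gives the shifted kernel a positive part with compact support.
-/
theorem exists_gauss_le (N : ℕ) {δ : ℝ} (hδ : 0 < δ) :
    ∃ R : ℝ, ∀ x : EuclideanSpace ℝ (Fin N), R ≤ ‖x‖ → ∀ τ ∈ Ioc (0 : ℝ) 4, gauss x τ ≤ δ := by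
  have h0 : Tendsto (fun R : ℝ => ((N / 2 + 1) / (R ^ 2 / 4)) ^ (N / 2 + 1 : ℝ)) atTop
      (𝓝 (0 ^ (N / 2 + 1 : ℝ))) :=
    (Tendsto.div_atTop tendsto_const_nhds
      ((tendsto_pow_atTop two_ne_zero).atTop_div_const (by norm_num))).rpow_const
      (Or.inr (by positivity))
  rw [Real.zero_rpow (by positivity)] at h0
  obtain ⟨R, hR, hR0⟩ := ((h0.eventually_le_const (show (0 : ℝ) < δ / 4 by positivity)).and
    (eventually_gt_atTop 0)).exists
  refine ⟨R, fun x hx τ hτ => ?_⟩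
  have h1 := (inv_mul_gauss_le hR0 hx hτ.1).trans hR
  rw [inv_mul_le_iff₀ hτ.1] at h1
  nlinarith [hτ.2]

theorem le_gauss {N : ℕ} {x : EuclideanSpace ℝ (Fin N)} (hx : ‖x‖ ≤ 4) {τ : ℝ} (h1 : 1 ≤ τ)
    (h3 : τ ≤ 3) : (3 : ℝ) ^ (-(N / 2 : ℝ)) * Real.exp (-4) ≤ gauss x τ := by
  unfold gauss
  refine mul_le_mul (Real.rpow_le_rpow_of_nonpos (by linarith) h3 ?_)
    (Real.exp_le_exp.2 (neg_le_neg ?_)) (Real.exp_pos _).le (by positivity)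
  · exact neg_nonpos.2 (by positivity)
  · rw [div_le_iff₀ (by linarith)]
    nlinarith [norm_nonneg x]

theorem gauss_le_one {N : ℕ} (x : EuclideanSpace ℝ (Fin N)) {τ : ℝ} (h1 : 1 ≤ τ) :
    gauss x τ ≤ 1 := by
  unfold gauss
  refine mul_le_one₀ (Real.rpow_le_one_of_one_le_of_nonpos h1 (neg_nonpos.2 (by positivity)))
    (Real.exp_pos _).le (Real.exp_le_one_iff.2 (neg_nonpos.2 (by positivity)))

theorem le_of_hasDerivAt_nonneg {f f' : ℝ → ℝ} {a b : ℝ} (hab : a ≤ b)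
    (hf : ∀ s ∈ Icc a b, HasDerivAt f (f' s) s) (h0 : ∀ s ∈ Icc a b, 0 ≤ f' s) : f a ≤ f b := by
  refine monotoneOn_of_hasDerivWithinAt_nonneg (convex_Icc a b)
    (fun s hs => (hf s hs).continuousAt.continuousWithinAt)
    (fun s hs => (hf s (interior_subset hs)).hasDerivWithinAt)
    (fun s hs => h0 s (interior_subset hs)) (left_mem_Icc.2 hab) (right_mem_Icc.2 hab) hab

/-! ### The test functions and their limit -/

/-- A cutoff function equal to `1` on the unit ball and supported in the ball of radius `2`. -/
noncomputable def cutoff (N : ℕ) : ContDiffBump (0 : EuclideanSpace ℝ (Fin N)) :=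
  ⟨1, 2, one_pos, one_lt_two⟩

theorem cutoff_eq_one {N : ℕ} {x : EuclideanSpace ℝ (Fin N)} (hx : ‖x‖ ≤ 1) :
    cutoff N x = 1 :=
  (cutoff N).one_of_mem_closedBall (mem_closedBall_zero_iff.2 hx)

theorem cutoff_eq_zero {N : ℕ} {x : EuclideanSpace ℝ (Fin N)} (hx : 2 ≤ ‖x‖) :
    cutoff N x = 0 :=
  (cutoff N).zero_of_le_dist (by simpa [cutoff] using hx)

/-- The truncated heat kernel `cutoff * gauss` solves the backward heat equation up to an error
which is bounded uniformly in the position of the pole. -/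
theorem exists_truncated_gauss_bound (N : ℕ) :
    ∃ M : ℝ, 0 ≤ M ∧ ∀ b : ℝ, -1 < b → b ≤ 0 →
      ∃ (G₁ G₂ : Fin N → EuclideanSpace ℝ (Fin N) → ℝ → ℝ)
        (G_t : EuclideanSpace ℝ (Fin N) → ℝ → ℝ),
        HasParabolicDerivs (Iio b) (fun x s => cutoff N x * gauss x (b - s)) G₁ G₂ G_t ∧
        ∀ s ∈ Icc (-2 : ℝ) (-1), ∀ x, G_t x s + ∑ i, G₂ i x s ≤ M ∧
          (2 < ‖x‖ → G_t x s + ∑ i, G₂ i x s = 0) := by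
  set φ : SpaceTime N → ℝ := fun z => cutoff N z.1 with hφ
  have hsmooth : ContDiff ℝ ∞ φ := (cutoff N).contDiff.comp contDiff_fst
  have hder := HasParabolicDerivs.of_contDiff hsmooth univ
  set φ₁ := fun (i : Fin N) (x : EuclideanSpace ℝ (Fin N)) (s : ℝ) =>
    fderiv ℝ φ (x, s) (EuclideanSpace.single i 1, 0) with hφ₁
  set φ₂ := fun (i : Fin N) (x : EuclideanSpace ℝ (Fin N)) (s : ℝ) =>
    fderiv ℝ (fderiv ℝ φ) (x, s) (EuclideanSpace.single i 1, 0) (EuclideanSpace.single i 1, 0)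
    with hφ₂
  have hφt : ∀ x s, fderiv ℝ φ (x, s) (0, 1) = 0 := fun x s =>
    (hder.time s (mem_univ s) x).unique (hasDerivAt_const s (φ (x, 0)))
  -- The cutoff is locally constant off the annulus `1 ≤ ‖x‖ ≤ 2`, so the error lives there, away
  -- from the singularity of the kernel.
  have hlocal : ∀ x s, ‖x‖ < 1 ∨ 2 < ‖x‖ → (∀ i, φ₁ i x s = 0) ∧ ∀ i, φ₂ i x s = 0 := by
    intro x s hx
    have hev : ∃ c : ℝ, φ =ᶠ[𝓝 (x, s)] fun _ => c := by
      rcases hx with hx | hx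
      · refine ⟨1, ?_⟩
        filter_upwards [(isOpen_lt continuous_fst.norm continuous_const).mem_nhds
          (show ‖((x, s) : SpaceTime N).1‖ < 1 from hx)] with z hz using cutoff_eq_one (le_of_lt hz)
      · refine ⟨0, ?_⟩
        filter_upwards [(isOpen_lt continuous_const continuous_fst.norm).mem_nhds
          (show 2 < ‖((x, s) : SpaceTime N).1‖ from hx)] with z hz using cutoff_eq_zero (le_of_lt hz)
    obtain ⟨c, hc⟩ := hev
    have h1 : fderiv ℝ φ =ᶠ[𝓝 (x, s)] fun _ => 0 := by
      refine hc.fderiv.trans (Eventually.of_forall fun z => ?_)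
      simp
    have h2 : fderiv ℝ (fderiv ℝ φ) (x, s) = 0 := by
      rw [h1.fderiv_eq]; simp
    exact ⟨fun i => by simp only [hφ₁, h1.eq_of_nhds]; simp,
      fun i => by simp only [hφ₂, h2]; simp⟩
  have hcont : ContinuousOn (fun z : SpaceTime N => ∑ i, (|φ₁ i z.1 z.2| + |φ₂ i z.1 z.2|))
      (univ ×ˢ univ) :=
    continuousOn_finsetSum _ fun i _ => (hder.cont₁ i).abs.add (hder.cont₂ i).abs
  obtain ⟨K, hK⟩ := ((isCompact_closedBall (0 : EuclideanSpace ℝ (Fin N)) 2).prod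
    (isCompact_Icc (a := (-2 : ℝ)) (b := -1))).exists_bound_of_continuousOn
      (hcont.mono (prod_mono (subset_univ _) (subset_univ _)))
  set P : ℝ := ((N / 2 + 1) / ((1 : ℝ) ^ 2 / 4)) ^ (N / 2 + 1 : ℝ) with hP
  have hP0 : 0 ≤ P := by positivity
  have hK0 : 0 ≤ K := (norm_nonneg _).trans (hK (0, -1) (by simp))
  refine ⟨K * (2 * P), by positivity, fun b hb1 hb0 => ?_⟩
  have hprod := (hder.mono (subset_univ (Iio b))).mul (hasParabolicDerivs_gauss (N := N) b)
  refine ⟨_, _, _, hprod, fun s hs x => ?_⟩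
  have hτ : 0 < b - s := by linarith [hs.2]
  have hτ2 : b - s ≤ 2 := by linarith [hs.1]
  set g := gauss x (b - s) with hg
  have hg0 : 0 ≤ g := gauss_nonneg x hτ
  -- Terms without a space derivative of the cutoff cancel, since the kernel solves the backward
  -- equation.
  have hL : fderiv ℝ φ (x, s) (0, 1) * g + φ (x, s) *
        (-(‖x‖ ^ 2 / (4 * (b - s) ^ 2) - N / (2 * (b - s))) * g) +
      ∑ i, (φ₂ i x s * g + 2 * (φ₁ i x s * (-(x i / (2 * (b - s))) * g)) +
        φ (x, s) * ((x i ^ 2 / (4 * (b - s) ^ 2) - 1 / (2 * (b - s))) * g)) =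
      ∑ i, (φ₂ i x s * g + 2 * (φ₁ i x s * (-(x i / (2 * (b - s))) * g))) := by
    rw [Finset.sum_add_distrib, ← Finset.mul_sum, sum_gauss_laplacian, hφt]
    ring
  rw [hL]
  by_cases hx : ‖x‖ < 1 ∨ 2 < ‖x‖
  · obtain ⟨h1, h2⟩ := hlocal x s hx
    have : ∑ i, (φ₂ i x s * g + 2 * (φ₁ i x s * (-(x i / (2 * (b - s))) * g))) = 0 :=
      Finset.sum_eq_zero fun i _ => by rw [h1, h2]; ring
    rw [this]
    exact ⟨by positivity, fun _ => rfl⟩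
  · rw [not_or, not_lt, not_lt] at hx
    refine ⟨?_, fun h => absurd h hx.2.not_gt⟩
    have hq : (b - s)⁻¹ * g ≤ P := inv_mul_gauss_le one_pos hx.1 hτ
    have hgP : g ≤ 2 * P := by
      rw [inv_mul_le_iff₀ hτ] at hq
      nlinarith
    have hbound : ∀ i, φ₂ i x s * g + 2 * (φ₁ i x s * (-(x i / (2 * (b - s))) * g)) ≤
        (|φ₁ i x s| + |φ₂ i x s|) * (2 * P) := fun i => by
      have hxi : |x i| ≤ 2 := (PiLp.norm_apply_le x i).trans hx.2
      have e1 : φ₂ i x s * g ≤ |φ₂ i x s| * (2 * P) :=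
        mul_le_mul (le_abs_self _) hgP hg0 (abs_nonneg _)
      have e2 : 2 * (φ₁ i x s * (-(x i / (2 * (b - s))) * g)) ≤ |φ₁ i x s| * (2 * P) := by
        have : 2 * (φ₁ i x s * (-(x i / (2 * (b - s))) * g)) =
            (φ₁ i x s * -(x i)) * ((b - s)⁻¹ * g) := by
          field_simp
        rw [this]
        have e3 : φ₁ i x s * -(x i) ≤ |φ₁ i x s| * 2 := by
          refine (le_abs_self _).trans ?_
          rw [abs_mul, abs_neg]
          gcongr
        calc (φ₁ i x s * -(x i)) * ((b - s)⁻¹ * g) ≤ (|φ₁ i x s| * 2) * P :=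
              mul_le_mul e3 hq (by positivity) (by positivity)
          _ = _ := by ring
      linarith
    refine (Finset.sum_le_sum fun i _ => hbound i).trans ?_
    rw [← Finset.sum_mul]
    refine mul_le_mul_of_nonneg_right ?_ (by positivity)
    exact (le_abs_self _).trans (hK (x, s) ⟨mem_closedBall_zero_iff.2 hx.2, hs⟩)

/-- The function `convexGlue (gauss + a s - c)` is a subsolution of the backward heat equation. -/
theorem exists_subsolution {N : ℕ} (a c b : ℝ) :
    ∃ (G₁ G₂ : Fin N → EuclideanSpace ℝ (Fin N) → ℝ → ℝ) (G_t : EuclideanSpace ℝ (Fin N) → ℝ → ℝ),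
      HasParabolicDerivs (Iio b) (fun x s => convexGlue (gauss x (b - s) + (a * s - c)))
        G₁ G₂ G_t ∧
      ∀ s x, a * convexGlueDeriv (gauss x (b - s) + (a * s - c)) ≤
        G_t x s + ∑ i, G₂ i x s := by
  have h := ((hasParabolicDerivs_gauss (N := N) b).add_affine a c).comp hasDerivAt_convexGlue
    hasDerivAt_convexGlueDeriv continuous_convexGlueDeriv₂
  refine ⟨_, _, _, h, fun s x => ?_⟩
  rw [Finset.sum_add_distrib, ← Finset.mul_sum, ← Finset.mul_sum, sum_gauss_laplacian]
  -- The chain rule leaves `F'' |∇gauss|² + a F'`; convexity lets the first term be dropped.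
  have h0 := mul_nonneg (convexGlueDeriv₂_nonneg (gauss x (b - s) + (a * s - c)))
    (Finset.sum_nonneg (s := Finset.univ) fun (i : Fin N) _ =>
      sq_nonneg (-(x i / (2 * (b - s))) * gauss x (b - s)))
  linarith

/-- Convergence of the truncated heat kernels to a multiple of the Dirac mass. -/
theorem tendsto_integral_truncated_gauss (N : ℕ) :
    ∃ κ : ℝ, 0 < κ ∧ ∀ (w : EuclideanSpace ℝ (Fin N) → ℝ), Continuous w → ∀ y,
      Tendsto (fun c : ℝ => ∫ x, w x * (cutoff N (x - y) * gauss (x - y) (c ^ 2)⁻¹)) atTop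
        (𝓝 (κ * w y)) := by
  set κ : ℝ := ∫ x : EuclideanSpace ℝ (Fin N), Real.exp (-(1 / 4) * ‖x‖ ^ 2) with hκ
  have hκ0 : 0 < κ := by
    rw [hκ, GaussianFourier.integral_rexp_neg_mul_sq_norm (by norm_num)]
    positivity
  refine ⟨κ, hκ0, fun w hw y => ?_⟩
  have hcomp : HasCompactSupport fun x => cutoff N (x - y) * w x := by
    refine HasCompactSupport.intro (isCompact_closedBall y 2) fun x hx => ?_
    rw [Metric.mem_closedBall, dist_eq_norm, not_le] at hx
    rw [cutoff_eq_zero hx.le, zero_mul]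
  have hcont : Continuous fun x => cutoff N (x - y) * w x :=
    ((cutoff N).continuous.comp (continuous_id.sub continuous_const)).mul hw
  have key := tendsto_integral_comp_smul_smul_of_integrable'
    (μ := (volume : Measure (EuclideanSpace ℝ (Fin N))))
    (φ := fun x => κ⁻¹ * Real.exp (-(1 / 4) * ‖x‖ ^ 2)) (fun x => by positivity)
    (by rw [integral_const_mul, ← hκ, inv_mul_cancel₀ hκ0.ne']) ?_
    (hcont.integrable_of_hasCompactSupport hcomp) (hcont.continuousAt (x := y))
  · have h2 := key.const_mul κ
    rw [sub_self, cutoff_eq_one (by simp), one_mul] at h2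
    refine h2.congr' ?_
    filter_upwards [eventually_gt_atTop 0] with c hc
    rw [← integral_const_mul]
    refine integral_congr_ae (Eventually.of_forall fun x => ?_)
    -- With `τ = c⁻²` the kernel is `c ^ N` times a fixed Gaussian at `c • (x - y)`: an approximate
    -- identity up to the factor `κ`.
    have e1 : ((c ^ 2)⁻¹ : ℝ) ^ (-(N / 2 : ℝ)) = c ^ N := by
      rw [Real.rpow_neg (by positivity), Real.inv_rpow (by positivity), inv_inv,
        ← Real.rpow_natCast c 2, ← Real.rpow_mul hc.le, ← Real.rpow_natCast c N]
      congr 1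
      push_cast
      ring
    simp only [gauss, e1, finrank_euclideanSpace_fin, smul_eq_mul, norm_smul, norm_sub_rev y x,
      Real.norm_of_nonneg hc.le]
    rw [show -(‖x - y‖ ^ 2 / (4 * (c ^ 2)⁻¹)) = -(1 / 4) * (c * ‖x - y‖) ^ 2 by field_simp]
    field_simp
  · rw [finrank_euclideanSpace_fin]
    have h3 := ((tendsto_rpow_abs_mul_exp_neg_mul_sq_cocompact
      (show (0 : ℝ) < 1 / 4 by norm_num) N).mono_left atTop_le_cocompact).comp
      (tendsto_norm_cobounded_atTop (E := EuclideanSpace ℝ (Fin N)))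
    have h4 := h3.const_mul κ⁻¹
    rw [mul_zero] at h4
    refine h4.congr fun x => ?_
    simp only [Function.comp, abs_norm, Real.rpow_natCast]
    ring

/-! ### The Harnack inequality for the heat equation -/

/-- Comparison of the test integrals with poles near `(y, -1)` and near `(0, 0)`. -/
theorem exists_integral_comparison (N : ℕ) :
    ∃ A : ℝ, 0 < A ∧ ∃ ε₀ : ℝ, 0 < ε₀ ∧ ∀ v : SpaceTime N → ℝ, ContDiff ℝ ∞ v → (∀ z, 0 ≤ v z) →
      (∀ z, ∑ i, fderiv ℝ (fderiv ℝ v) z (EuclideanSpace.single i 1, 0)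
        (EuclideanSpace.single i 1, 0) = fderiv ℝ v z (0, 1)) →
      ∀ y : EuclideanSpace ℝ (Fin N), ‖y‖ < 2 → ∀ ε : ℝ, 0 < ε → ε < ε₀ →
        ∫ x, v (x, -1) * (cutoff N (x - y) * gauss (x - y) ε) ≤
          A * ∫ x, v (x, 0) * (cutoff N x * gauss x ε) := by
  obtain ⟨M, hM0, hM⟩ := exists_truncated_gauss_bound N
  -- `γ` bounds the kernel from below for `‖x‖ ≤ 4` and `τ ∈ [1, 3]`. For `s ≥ -2` the shift
  -- satisfies `a s - c ≥ -γ / 2`, so at least `γ / 2` is left; for `s ≤ 1 / 2` it is at most `-3γ /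
  -- 16`, the level that fixes `R`.
  set γ : ℝ := (3 : ℝ) ^ (-(N / 2 : ℝ)) * Real.exp (-4) with hγ
  have hγ0 : 0 < γ := by positivity
  set a : ℝ := γ / 8 with ha
  set c : ℝ := γ / 4 with hc
  set q : ℝ := expNegInvGlue (γ / 2) with hq
  have hq0 : 0 < q := expNegInvGlue.pos_of_pos (by positivity)
  obtain ⟨R, hR⟩ := exists_gauss_le N (show 0 < 3 * γ / 16 by positivity)
  set P : ℝ := ((N / 2 + 1) / ((1 : ℝ) ^ 2 / 4)) ^ (N / 2 + 1 : ℝ) with hP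
  have hP0 : 0 < P := by positivity
  -- The first summand pays for the cutoff error, the second for the comparison at time `-2`.
  set A : ℝ := M / (a * q) + 1 / (γ / 2 * q) with hA
  have hA0 : 0 < A := by positivity
  -- The condition `ε * P < c` puts the time-`0` kernel below `c` outside the unit ball, so `G`
  -- vanishes there.
  refine ⟨A, hA0, min (1 / 2) (c / P), by positivity, fun v hv hv0 hheat y hy ε hε hε' => ?_⟩
  have hε1 : ε < 1 / 2 := hε'.trans_le (min_le_left _ _)
  have hεP : ε * P < c := (lt_div_iff₀ hP0).1 (hε'.trans_le (min_le_right _ _))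
  set h : EuclideanSpace ℝ (Fin N) → ℝ → ℝ := fun x s => gauss x (ε - s) + (a * s - c) with hh
  set G : EuclideanSpace ℝ (Fin N) → ℝ → ℝ := fun x s => convexGlue (h x s) with hG
  set H : EuclideanSpace ℝ (Fin N) → ℝ → ℝ := fun x s =>
    cutoff N (x - y) * gauss (x - y) (-1 + ε - s) with hH
  obtain ⟨G₁, G₂, G_t, hGd, hGL⟩ := exists_subsolution (N := N) a c ε
  obtain ⟨H₁, H₂, H_t, hHd', hHL⟩ := hM (-1 + ε) (by linarith) (by linarith)
  have hHd := hHd'.comp_sub y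
  have hvd := HasParabolicDerivs.of_contDiff hv univ
  -- The open time interval contains `[-2, 0]` and stops before the pole at `ε`; on it `ε - r` stays
  -- in `(0, 4]`, as the choice of `R` requires.
  have dG : ∀ s ∈ Icc (-2 : ℝ) 0, _ := fun s hs =>
    hasDerivAt_integral_mul (R := R) (isOpen_Ioo (a := (-3 : ℝ)) (b := min (ε / 2) (1 / 2)))
      (hvd.mono (subset_univ _)) (fun s _ x => hheat (x, s))
      (hGd.mono fun r hr => show r < ε by
        linarith [hr.2.trans_le (min_le_left _ _)])
      (fun r hr x hx => by
        have h1 := hr.1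
        have h2 := hr.2.trans_le (min_le_left _ _)
        have h3 := hr.2.trans_le (min_le_right _ _)
        refine convexGlue_of_nonpos ?_
        have h4 := hR x hx (ε - r) ⟨by linarith, by linarith⟩
        nlinarith) (s := s)
      ⟨by linarith [hs.1], lt_of_le_of_lt hs.2 (by positivity)⟩
  have dH : ∀ s ∈ Icc (-2 : ℝ) (-1), _ := fun s hs =>
    hasDerivAt_integral_mul (R := 4) (isOpen_Iio (a := -1 + ε))
      (hvd.mono (subset_univ _)) (fun s _ x => hheat (x, s)) hHd
      (fun r _ x hx => by
        have : 2 ≤ ‖x - y‖ := by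
          linarith [norm_sub_norm_le x y]
        simp only [cutoff_eq_zero this, zero_mul]) (s := s)
      (show s < -1 + ε by linarith [hs.2])
  have hlow : ∀ s ∈ Icc (-2 : ℝ) (-1), ∀ x : EuclideanSpace ℝ (Fin N), ‖x‖ ≤ 4 →
      γ / 2 ≤ h x s := fun s hs x hx => by
    have := le_gauss hx (τ := ε - s) (by linarith [hs.2]) (by linarith [hs.1])
    simp only [hh]
    nlinarith [hs.1]
  have hin : ∀ x : EuclideanSpace ℝ (Fin N), ¬ 2 < ‖x - y‖ → ‖x‖ ≤ 4 := fun x hx => by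
    linarith [norm_sub_norm_le x y, not_lt.1 hx]
  have hGL0 : ∀ s x, 0 ≤ G_t x s + ∑ i, G₂ i x s := fun s x =>
    le_trans (mul_nonneg (by positivity) (convexGlueDeriv_nonneg _)) (hGL s x)
  have hcompare : ∀ s ∈ Icc (-2 : ℝ) (-1), ∀ x, H_t (x - y) s + ∑ i, H₂ i (x - y) s ≤
      A * (G_t x s + ∑ i, G₂ i x s) := fun s hs x => by
    by_cases hx : 2 < ‖x - y‖
    · rw [(hHL s hs (x - y)).2 hx]
      exact mul_nonneg hA0.le (hGL0 s x)
    · have h1 := hlow s hs x (hin x hx)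
      -- For positive `r` the derivative `(1 + r⁻¹) * expNegInvGlue r` is at least `expNegInvGlue
      -- r`, which is monotone.
      have h2 : q ≤ convexGlueDeriv (h x s) := by
        refine (expNegInvGlue.monotone h1).trans ?_
        refine le_mul_of_one_le_left (expNegInvGlue.nonneg _) ?_
        have : 0 ≤ (h x s)⁻¹ := inv_nonneg.2 (by linarith)
        linarith
      have h3 : a * q ≤ G_t x s + ∑ i, G₂ i x s :=
        le_trans (mul_le_mul_of_nonneg_left h2 (by positivity)) (hGL s x)
      calc _ ≤ M := (hHL s hs (x - y)).1
        _ = M / (a * q) * (a * q) := (div_mul_cancel₀ _ (by positivity)).symm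
        _ ≤ A * (a * q) := by
            refine mul_le_mul_of_nonneg_right ?_ (by positivity)
            rw [hA]
            exact le_add_of_nonneg_right (by positivity)
        _ ≤ _ := mul_le_mul_of_nonneg_left h3 hA0.le
  have hinit : ∀ x, H x (-2) ≤ A * G x (-2) := fun x => by
    by_cases hx : 2 < ‖x - y‖
    · simp only [hH, cutoff_eq_zero hx.le, zero_mul]
      exact mul_nonneg hA0.le (convexGlue_nonneg _)
    · have h1 := hlow (-2) (by norm_num) x (hin x hx)
      have h2 : γ / 2 * q ≤ G x (-2) :=
        mul_le_mul h1 (expNegInvGlue.monotone h1) hq0.le (by linarith)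
      calc H x (-2) ≤ 1 := by
            refine mul_le_one₀ (cutoff N).le_one (gauss_nonneg _ (by linarith))
              (gauss_le_one _ (by linarith))
        _ = 1 / (γ / 2 * q) * (γ / 2 * q) := by field_simp
        _ ≤ A * (γ / 2 * q) := by
            refine mul_le_mul_of_nonneg_right ?_ (by positivity)
            rw [hA]
            exact le_add_of_nonneg_left (by positivity)
        _ ≤ _ := mul_le_mul_of_nonneg_left h2 hA0.le
  have sub02 : ∀ {s : ℝ}, s ∈ Icc (-2 : ℝ) (-1) → s ∈ Icc (-2 : ℝ) 0 := fun hs =>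
    ⟨hs.1, hs.2.trans (by norm_num)⟩
  have step₁ : 0 ≤ A * (∫ x, v (x, -2) * G x (-2)) - ∫ x, v (x, -2) * H x (-2) := by
    have hm : (-2 : ℝ) ∈ Icc (-2 : ℝ) (-1) := by norm_num
    rw [sub_nonneg, ← integral_const_mul]
    refine integral_mono (dH _ hm).2.2 ((dG _ (sub02 hm)).2.2.const_mul A) fun x => ?_
    have := mul_le_mul_of_nonneg_left (hinit x) (hv0 (x, -2))
    simp only
    linarith
  have step₂ := le_of_hasDerivAt_nonneg (a := -2) (b := -1) (by norm_num)
    (fun s hs => ((dG s (sub02 hs)).1.const_mul A).sub (dH s hs).1) (fun s hs => by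
      rw [sub_nonneg, ← integral_const_mul]
      refine integral_mono (dH _ hs).2.1 ((dG _ (sub02 hs)).2.1.const_mul A) fun x => ?_
      have := mul_le_mul_of_nonneg_left (hcompare s hs x) (hv0 (x, s))
      simp only
      linarith)
  have step₃ := le_of_hasDerivAt_nonneg (a := -1) (b := 0) (by norm_num)
    (fun s hs => (dG s ⟨by linarith [hs.1], hs.2⟩).1) (fun s hs =>
      integral_nonneg fun x => mul_nonneg (hv0 _) (hGL0 s x))
  have step₄ : ∫ x, v (x, 0) * G x 0 ≤ ∫ x, v (x, 0) * (cutoff N x * gauss x ε) := by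
    have cv : Continuous fun x => v (x, 0) := hv.continuous.comp (by fun_prop)
    have cg : Continuous fun x : EuclideanSpace ℝ (Fin N) => gauss x ε := by
      unfold gauss; fun_prop
    have hcs : HasCompactSupport fun x => cutoff N x := (cutoff N).hasCompactSupport
    refine integral_mono (dG 0 (by norm_num)).2.2 ((cv.mul ((cutoff N).continuous.mul
      cg)).integrable_of_hasCompactSupport hcs.mul_right.mul_left) fun x => ?_
    refine mul_le_mul_of_nonneg_left ?_ (hv0 _)
    simp only [hG, hh, sub_zero, mul_zero, zero_sub]
    rcases le_or_gt ‖x‖ 1 with hx | hx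
    · rw [cutoff_eq_one hx, one_mul]
      exact convexGlue_le (gauss_nonneg x hε) (by linarith)
    · have h1 := inv_mul_gauss_le one_pos hx.le hε
      rw [← hP, inv_mul_le_iff₀ hε] at h1
      rw [convexGlue_of_nonpos (by linarith)]
      exact mul_nonneg (cutoff N).nonneg (gauss_nonneg x hε)
  simp only [Pi.sub_apply] at step₂
  have step₅ : ∫ x, v (x, -1) * H x (-1) ≤ A * ∫ x, v (x, -1) * G x (-1) := by
    linarith
  have hHε : ∀ x, H x (-1) = cutoff N (x - y) * gauss (x - y) ε := fun x => by
    simp only [hH]; congr 2; ring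
  simp only [hHε] at step₅
  exact step₅.trans (mul_le_mul_of_nonneg_left (step₃.trans step₄) hA0.le)

/-- A scale-invariant Harnack inequality for non-negative solutions of the heat equation on the
whole space-time. -/
theorem exists_heat_harnack (N : ℕ) :
    ∃ A : ℝ, 0 < A ∧ ∀ v : SpaceTime N → ℝ, ContDiff ℝ ∞ v → (∀ z, 0 ≤ v z) →
      (∀ z, ∑ i, fderiv ℝ (fderiv ℝ v) z (EuclideanSpace.single i 1, 0)
        (EuclideanSpace.single i 1, 0) = fderiv ℝ v z (0, 1)) →
      ∀ y : EuclideanSpace ℝ (Fin N), ‖y‖ < 2 → v (y, -1) ≤ A * v (0, 0) := by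
  obtain ⟨A, hA, ε₀, hε₀, h⟩ := exists_integral_comparison N
  obtain ⟨κ, hκ, hlim⟩ := tendsto_integral_truncated_gauss N
  refine ⟨A, hA, fun v hv hv0 hheat y hy => ?_⟩
  have c₁ : Continuous fun x => v (x, -1) := hv.continuous.comp (by fun_prop)
  have c₀ : Continuous fun x => v (x, 0) := hv.continuous.comp (by fun_prop)
  have hε : ∀ᶠ c : ℝ in atTop, (c ^ 2)⁻¹ < ε₀ :=
    (tendsto_inv_atTop_zero.comp (tendsto_pow_atTop two_ne_zero)).eventually_lt_const hε₀
  have hle := le_of_tendsto_of_tendsto (hlim _ c₁ y) ((hlim _ c₀ 0).const_mul A) (by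
    filter_upwards [hε, eventually_gt_atTop 0] with c hc hc0
    simpa only [sub_zero] using h v hv hv0 hheat y hy (c ^ 2)⁻¹ (by positivity) hc)
  rw [mul_left_comm] at hle
  exact le_of_mul_le_mul_left hle hκ

/-! ### The orthogonal flow of the drift -/

/-- The flow `exp(-τB)` as a continuous linear map. -/
noncomputable def flow {N : ℕ} (B : Matrix (Fin N) (Fin N) ℝ) (τ : ℝ) :
    EuclideanSpace ℝ (Fin N) →L[ℝ] EuclideanSpace ℝ (Fin N) :=
  NormedSpace.exp (τ • -Matrix.toEuclideanCLM (n := Fin N) (𝕜 := ℝ) B)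

section L2

open scoped Matrix.Norms.L2Operator

/-- A continuous algebra homomorphism commutes with the exponential. -/
theorem toEuclideanLin_E {N : ℕ} (B : Matrix (Fin N) (Fin N) ℝ) (τ : ℝ)
    (x : EuclideanSpace ℝ (Fin N)) : Matrix.toEuclideanLin (E B τ) x = flow B τ x := by
  let _ : NormedAlgebra ℚ (Matrix (Fin N) (Fin N) ℝ) := NormedAlgebra.restrictScalars ℚ ℝ _
  let _ : NormedAlgebra ℚ (EuclideanSpace ℝ (Fin N) →L[ℝ] EuclideanSpace ℝ (Fin N)) :=
    NormedAlgebra.restrictScalars ℚ ℝ _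
  have hc : Continuous (Matrix.toEuclideanCLM (n := Fin N) (𝕜 := ℝ)) :=
    LinearMap.continuous_of_finiteDimensional
      (Matrix.toEuclideanCLM (n := Fin N) (𝕜 := ℝ)).toAlgEquiv.toLinearMap
  have h := NormedSpace.map_exp (Matrix.toEuclideanCLM (n := Fin N) (𝕜 := ℝ)) hc (-(τ • B))
  have e : Matrix.toEuclideanCLM (n := Fin N) (𝕜 := ℝ) (-(τ • B)) =
      τ • -Matrix.toEuclideanCLM (n := Fin N) (𝕜 := ℝ) B := by
    rw [map_neg, map_smul, smul_neg]
  rw [e] at h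
  exact congrArg (fun T : EuclideanSpace ℝ (Fin N) →L[ℝ] EuclideanSpace ℝ (Fin N) => T x) h

end L2

theorem flow_zero {N : ℕ} (B : Matrix (Fin N) (Fin N) ℝ) (x : EuclideanSpace ℝ (Fin N)) :
    flow B 0 x = x := by
  simp [flow, NormedSpace.exp_zero]

theorem exp_smul_mul_exp_neg_smul {𝔸 : Type*} [NormedRing 𝔸] [NormedAlgebra ℝ 𝔸] [CompleteSpace 𝔸]
    (a : 𝔸) (τ : ℝ) : NormedSpace.exp (τ • a) * NormedSpace.exp (-τ • a) = 1 := by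
  let _ : NormedAlgebra ℚ 𝔸 := NormedAlgebra.restrictScalars ℚ ℝ 𝔸
  rw [neg_smul, ← NormedSpace.exp_add_of_commute (Commute.refl _).neg_right, add_neg_cancel,
    NormedSpace.exp_zero]

theorem flow_flow_neg {N : ℕ} (B : Matrix (Fin N) (Fin N) ℝ) (τ : ℝ)
    (x : EuclideanSpace ℝ (Fin N)) : flow B τ (flow B (-τ) x) = x := by
  exact congrArg (fun T : EuclideanSpace ℝ (Fin N) →L[ℝ] EuclideanSpace ℝ (Fin N) => T x)
    (exp_smul_mul_exp_neg_smul (-Matrix.toEuclideanCLM (n := Fin N) (𝕜 := ℝ) B) τ)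

/-- The exponential of a skew-adjoint operator is unitary; skewness of `B` enters here. -/
theorem flow_mem_unitary {N : ℕ} {B : Matrix (Fin N) (Fin N) ℝ} (hB : B.transpose = -B) (τ : ℝ) :
    flow B τ ∈ unitary (EuclideanSpace ℝ (Fin N) →L[ℝ] EuclideanSpace ℝ (Fin N)) := by
  let _ : NormedAlgebra ℚ (EuclideanSpace ℝ (Fin N) →L[ℝ] EuclideanSpace ℝ (Fin N)) :=
    NormedAlgebra.restrictScalars ℚ ℝ _
  refine NormedSpace.exp_mem_unitary_of_mem_skewAdjoint ?_
  rw [skewAdjoint.mem_iff, star_smul, star_neg, ← map_star, Matrix.star_eq_conjTranspose,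
    Matrix.conjTranspose_eq_transpose_of_trivial, hB, map_neg]
  simp

theorem norm_flow {N : ℕ} {B : Matrix (Fin N) (Fin N) ℝ} (hB : B.transpose = -B) (τ : ℝ)
    (x : EuclideanSpace ℝ (Fin N)) : ‖flow B τ x‖ = ‖x‖ :=
  ContinuousLinearMap.norm_map_of_mem_unitary (flow_mem_unitary hB τ) x

theorem hasDerivAt_flow {N : ℕ} (B : Matrix (Fin N) (Fin N) ℝ) (τ : ℝ)
    (x : EuclideanSpace ℝ (Fin N)) :
    HasDerivAt (fun r => flow B r x) (-Matrix.toEuclideanLin B (flow B τ x)) τ := by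
  have h := (hasDerivAt_exp_smul_const' (-Matrix.toEuclideanCLM (n := Fin N) (𝕜 := ℝ) B) τ).clm_apply
    (hasDerivAt_const τ x)
  refine h.congr_deriv ?_
  rw [map_zero, add_zero]
  rfl

theorem contDiff_flow {N : ℕ} (B : Matrix (Fin N) (Fin N) ℝ) : ContDiff ℝ ∞ (flow B) := by
  refine contDiff_iff_contDiffAt.2 fun τ => ?_
  exact (NormedSpace.exp_analytic (𝕂 := ℝ) _).contDiffAt.comp τ (contDiff_id.smul
    contDiff_const).contDiffAt

/-! ### Reduction to the heat equation -/

/-- The basis is left arbitrary so that the Laplacian can be computed in the basis rotated by the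
flow. -/
theorem laplacian_slice {N : ℕ} {u : SpaceTime N → ℝ} (hu : ContDiff ℝ ∞ u) (z : SpaceTime N)
    (b : OrthonormalBasis (Fin N) ℝ (EuclideanSpace ℝ (Fin N))) :
    Laplacian.laplacian (fun x => u (x, z.2)) z.1 =
      ∑ i, fderiv ℝ (fderiv ℝ u) z (b i, 0) (b i, 0) := by
  have hu' : ContDiff ℝ ∞ (fderiv ℝ u) := hu.fderiv_right (by simp)
  have hd : Differentiable ℝ u := hu.differentiable (by simp)
  have hd' : Differentiable ℝ (fderiv ℝ u) := hu'.differentiable (by simp)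
  have hinl : ∀ x : EuclideanSpace ℝ (Fin N), HasFDerivAt (fun y => (y, z.2))
      (ContinuousLinearMap.inl ℝ (EuclideanSpace ℝ (Fin N)) ℝ) x := fun x =>
    hasFDerivAt_prodMk_left x z.2
  have h1 : fderiv ℝ (fun x => u (x, z.2)) = fun x =>
      (fderiv ℝ u (x, z.2)).comp (ContinuousLinearMap.inl ℝ (EuclideanSpace ℝ (Fin N)) ℝ) :=
    funext fun x => ((hd _).hasFDerivAt.comp x (hinl x)).fderiv
  rw [InnerProductSpace.laplacian_eq_iteratedFDeriv_orthonormalBasis _ b]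
  refine Finset.sum_congr rfl fun i _ => ?_
  rw [iteratedFDeriv_two_apply, h1]
  have h2 := (((hd' z).hasFDerivAt.comp z.1 (hinl z.1)).clm_comp
    (hasFDerivAt_const (ContinuousLinearMap.inl ℝ (EuclideanSpace ℝ (Fin N)) ℝ) z.1)).fderiv
  simp only [Function.comp_def] at h2
  rw [h2]
  simp

theorem operator_eq {N : ℕ} (B : Matrix (Fin N) (Fin N) ℝ) {u : SpaceTime N → ℝ}
    (hu : ContDiff ℝ ∞ u) (z : SpaceTime N)
    (b : OrthonormalBasis (Fin N) ℝ (EuclideanSpace ℝ (Fin N))) :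
    operator B u z = ∑ i, fderiv ℝ (fderiv ℝ u) z (b i, 0) (b i, 0)
      + fderiv ℝ u z (Matrix.toEuclideanLin B z.1, 0) - fderiv ℝ u z (0, 1) := by
  have hd : Differentiable ℝ u := hu.differentiable (by simp)
  have h : HasFDerivAt (fun x => u (x, z.2))
      ((fderiv ℝ u z).comp (ContinuousLinearMap.inl ℝ (EuclideanSpace ℝ (Fin N)) ℝ)) z.1 :=
    HasFDerivAt.comp (f := fun x => (x, z.2)) (g := u) z.1 (hd z).hasFDerivAt
      (hasFDerivAt_prodMk_left z.1 z.2)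
  rw [operator, laplacian_slice hu z b, inner_gradient_right,
    ((HasParabolicDerivs.of_contDiff hu univ).time z.2 (mem_univ _) z.1).deriv, h.fderiv]
  simp

/-- In the coordinates which move along the flow of the drift, and after a parabolic dilation
centred at `z₀`, solutions of `operator B u = 0` solve the heat equation. -/
theorem exists_heat_solution {N : ℕ} {B : Matrix (Fin N) (Fin N) ℝ} (hB : B.transpose = -B)
    {u : SpaceTime N → ℝ} (hu : ContDiff ℝ ∞ u) (hL : ∀ z, operator B u z = 0) (l t₀ : ℝ)
    (x₀ : EuclideanSpace ℝ (Fin N)) :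
    let v : SpaceTime N → ℝ := fun z =>
      u (flow B (l ^ 2 * z.2) (l • z.1 + x₀), t₀ + l ^ 2 * z.2)
    ContDiff ℝ ∞ v ∧ ∀ z, ∑ i, fderiv ℝ (fderiv ℝ v) z (EuclideanSpace.single i 1, 0)
        (EuclideanSpace.single i 1, 0) = fderiv ℝ v z (0, 1) := by
  intro v
  have hd : Differentiable ℝ u := hu.differentiable (by simp)
  have hu' : ContDiff ℝ ∞ (fderiv ℝ u) := hu.fderiv_right (by simp)
  have hd' : Differentiable ℝ (fderiv ℝ u) := hu'.differentiable (by simp)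
  have hv : ContDiff ℝ ∞ v := by
    refine hu.comp (ContDiff.prodMk (ContDiff.clm_apply ((contDiff_flow B).comp ?_) ?_) ?_) <;>
      fun_prop
  refine ⟨hv, fun ⟨ξ, s⟩ => ?_⟩
  have hder := HasParabolicDerivs.of_contDiff hv univ
  set T := flow B (l ^ 2 * s) with hT
  set p : EuclideanSpace ℝ (Fin N) → SpaceTime N := fun η => (T (l • η + x₀), t₀ + l ^ 2 * s) with hp
  have hline : ∀ (w : SpaceTime N → ℝ) (w' : SpaceTime N →L[ℝ] ℝ) (η e : EuclideanSpace ℝ (Fin N)),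
      HasFDerivAt w w' (p η) →
      HasLineDerivAt ℝ (fun y => w (p y)) (w' (l • T e, 0)) η e := fun w w' η e hw => by
    have h := hasLineDerivAt_slice hw (l • T e)
    unfold HasLineDerivAt at h ⊢
    refine h.congr_of_eventuallyEq (Eventually.of_forall fun t => ?_)
    simp only [hp, smul_add, map_add, map_smul, smul_comm t l]
    congr 2
    abel
  have h₁ : ∀ i η, fderiv ℝ v (η, s) (EuclideanSpace.single i 1, 0) =
      fderiv ℝ u (p η) (l • T (EuclideanSpace.single i 1), 0) := fun i η =>
    (hder.line s (mem_univ s) i η).unique (hline u _ η _ (hd _).hasFDerivAt)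
  have h₂ : ∀ i, fderiv ℝ (fderiv ℝ v) (ξ, s) (EuclideanSpace.single i 1, 0)
      (EuclideanSpace.single i 1, 0) = l ^ 2 * fderiv ℝ (fderiv ℝ u) (p ξ)
        (T (EuclideanSpace.single i 1), 0) (T (EuclideanSpace.single i 1), 0) := fun i => by
    have h := hder.line₂ s (mem_univ s) i ξ
    simp only [h₁] at h
    rw [h.unique (hline (fun z => fderiv ℝ u z (l • T (EuclideanSpace.single i 1), 0)) _ ξ _
      ((ContinuousLinearMap.apply ℝ ℝ
        ((l • T (EuclideanSpace.single i 1), 0) : SpaceTime N)).hasFDerivAt.comp (p ξ)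
        (hd' (p ξ)).hasFDerivAt))]
    have e : ((l • T (EuclideanSpace.single i 1), 0) : SpaceTime N) =
        l • (T (EuclideanSpace.single i 1), 0) := by simp
    simp only [ContinuousLinearMap.comp_apply, ContinuousLinearMap.apply_apply, e, map_smul,
      _root_.smul_apply, smul_eq_mul]
    ring
  -- The velocity of the flow is `-Bx`, so the time derivative of `v` already contains the drift
  -- term.
  have h₃ : fderiv ℝ v (ξ, s) (0, 1) =
      l ^ 2 * (fderiv ℝ u (p ξ) (0, 1) -
        fderiv ℝ u (p ξ) (Matrix.toEuclideanLin B (p ξ).1, 0)) := by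
    have hs : HasDerivAt (fun r : ℝ => l ^ 2 * r) (l ^ 2) s := by
      simpa using (hasDerivAt_id s).const_mul (l ^ 2)
    have hc := ((hasDerivAt_flow B (l ^ 2 * s) (l • ξ + x₀)).scomp s hs).prodMk
      (hs.const_add t₀)
    rw [(hder.time s (mem_univ s) ξ).unique ((hd (p ξ)).hasFDerivAt.comp_hasDerivAt s hc)]
    have e : ((l ^ 2 • -Matrix.toEuclideanLin B (T (l • ξ + x₀)), l ^ 2) : SpaceTime N) =
        l ^ 2 • ((0, 1) - (Matrix.toEuclideanLin B (p ξ).1, 0)) := by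
      simp [hp]
    rw [e, map_smul, map_sub, smul_eq_mul]
  have hop := operator_eq B hu (p ξ) ((EuclideanSpace.basisFun (Fin N) ℝ).map
    (Unitary.linearIsometryEquiv ⟨T, flow_mem_unitary hB _⟩))
  rw [hL] at hop
  have hb : ∀ i, ((EuclideanSpace.basisFun (Fin N) ℝ).map
      (Unitary.linearIsometryEquiv ⟨T, flow_mem_unitary hB _⟩)) i =
        T (EuclideanSpace.single i 1) := fun i => by
    rw [OrthonormalBasis.map_apply, EuclideanSpace.basisFun_apply]
    rfl
  simp only [hb] at hop
  rw [Finset.sum_congr rfl fun i _ => h₂ i, ← Finset.mul_sum, h₃]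
  congr 1
  linarith

end Kolmogorov

theorem theorem1p4 (N : ℕ) (B : Matrix (Fin N) (Fin N) ℝ) (hB : B.transpose = -B) :
    ∃ C : ℝ, 0 < C ∧
      ∀ u : Kolmogorov.SpaceTime N → ℝ,
        ContDiff ℝ ∞ u →
        (∀ z, 0 ≤ u z) →
        (∀ z, Kolmogorov.operator B u z = 0) →
        ∀ z₀ : Kolmogorov.SpaceTime N, ∀ z ∈ Kolmogorov.paraboloid B z₀, u z ≤ C * u z₀ := by
  obtain ⟨A, hA, h⟩ := Kolmogorov.exists_heat_harnack N
  refine ⟨A, hA, fun u hu hu0 hL z₀ z hz => ?_⟩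
  obtain ⟨⟨y, τ⟩, hw, rfl⟩ := hz
  have hw' : τ < -(‖y‖ ^ 2 / 4) := hw
  have hτ : 0 < -τ := by nlinarith [sq_nonneg ‖y‖]
  have hl : 0 < √(-τ) := Real.sqrt_pos.2 hτ
  have hl2 : √(-τ) ^ 2 = -τ := Real.sq_sqrt hτ.le
  obtain ⟨hv, hheat⟩ := Kolmogorov.exists_heat_solution hB hu hL (√(-τ)) z₀.2 z₀.1
  -- With `l² = -τ`, this point at time `-1` is sent to `z₀ ∘ (y, τ)`, and the origin at time `0` to
  -- `z₀`. Since the flow is isometric, its norm is `‖y‖ / √(-τ)`, which is below `2` exactly when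
  -- `(y, τ) ∈ P`.
  have key := h _ hv (fun z => hu0 _) hheat ((√(-τ))⁻¹ • Kolmogorov.flow B (-τ) y) (by
    rw [norm_smul, Kolmogorov.norm_flow hB, norm_inv, Real.norm_of_nonneg hl.le,
      inv_mul_lt_iff₀ hl]
    refine lt_of_pow_lt_pow_left₀ 2 (by positivity) ?_
    rw [mul_pow, hl2]
    linarith)
  simp only [hl2, smul_inv_smul₀ hl.ne', mul_zero, smul_zero, zero_add, add_zero,
    Kolmogorov.flow_zero, mul_neg, mul_one, neg_neg, map_add, Kolmogorov.flow_flow_neg] at key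
  simpa only [Kolmogorov.comp, Kolmogorov.toEuclideanLin_E] using key
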